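/- Let $U$ be a $2\times 2$ unitary matrix acting on $\mathbb C^2=\mathrm{span}(|R\rangle,|L\rangle)$, where $R=+1$ and $L=-1$. Let $Q=T(I\otimes U)$ be the quantum walk operator on $\ell^2(\mathbb Z\times\{R,L\})$, where $T|x\rangle|\sigma\rangle=|x+\sigma\rangle|\sigma\rangle$. For a set $B\subset\mathbb Z$ of absorbing positions let $\Pi^B_{\mathrm{no}}$ be the orthogonal projection onto the closed span of the vectors $|x\rangle|\sigma\rangle$ with $x\notin B$. For $\alpha,\beta\in\mathbb C$ with $|\alpha|^2+|\beta|^2=1$ put $\psi=|1\rangle(\alpha|R\rangle+\beta|L\rangle)$ and, for $B\ni 0$, $$P_B(\alpha,\beta)=\sum_{t=1}^\infty\ \sum_{\sigma\in\{R,L\}}\left|\langle 0,\sigma|\,Q\,(\Pi^B_{\mathrm{no}}Q)^{t-1}|\psi\rangle\right|^2 ,$$ the probability that the walk started at position $1$ with coin state $(\alpha,\beta)$ is eventually absorbed at $0$ before being absorbed at any other position of $B$. Write $P_\infty^{(1)}(\alpha,\beta)=P_{\{0\}}(\alpha,\beta)$ for the semi-infinite walk and $P_n^{(1)}(\alpha,\beta)=P_{\{0,n\}}(\alpha,\beta)$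 for the finite walk. **Theorem 4.3.** For every $2\times2$ unitary matrix $U$ there is an $N$, depending only on $U$, such that for all $n\ge N$ and all coin states $(\alpha,\beta)$ with $|\alpha|^2+|\beta|^2=1$, $$P_\infty^{(1)}(\alpha,\beta)\le P_n^{(1)}(\alpha,\beta).$$ That is, a second absorbing boundary placed sufficiently far away does not decrease the probability of absorption at the origin. -/

import Mathlib

open scoped ENNReal

noncomputable section

namespace QuantumWalk

/-- The Hilbert space `ℓ²(G × S)` of a walk on the group `G` with directions `S ⊆ G`:
the coefficient of `ψ` at `(g, σ)` is the amplitude of the basis vector `|g⟩|σ⟩`. -/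
abbrev State (G : Type*) (S : Finset G) : Type _ := lp (fun _ : G × S => ℂ) 2

section

variable {G : Type*} {S : Finset G}

theorem memlp_of_summable {f : G × S → ℂ} (h : Summable fun x => ‖f x‖ ^ 2) :
    Memℓp f 2 := by
  apply memℓp_gen
  simpa using h

theorem summable_sq (ψ : State G S) : Summable fun x => ‖ψ x‖ ^ 2 := by
  have h := (lp.memℓp ψ).summable (by norm_num)
  simpa using h

theorem memlp_coin (U : Matrix S S ℂ) (ψ : State G S) :
    Memℓp (fun x : G × S => ∑ τ, U x.2 τ * ψ (x.1, τ)) 2 := by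
  apply memlp_of_summable
  have hb : Summable fun g : G => ∑ τ : S, ‖ψ (g, τ)‖ ^ 2 :=
    summable_sum fun τ _ =>
      (summable_sq ψ).comp_injective (i := fun g : G => (g, τ)) fun _ _ h => congrArg Prod.fst h
  have ha : Summable fun σ : S => ∑ τ : S, ‖U σ τ‖ ^ 2 := (hasSum_fintype _).summable
  refine Summable.of_nonneg_of_le (fun _ => by positivity) (fun x => ?_)
    (hb.mul_of_nonneg ha (fun _ => Finset.sum_nonneg fun _ _ => by positivity)
      (fun _ => Finset.sum_nonneg fun _ _ => by positivity))
  calc ‖∑ τ, U x.2 τ * ψ (x.1, τ)‖ ^ 2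
      ≤ (∑ τ, ‖U x.2 τ‖ * ‖ψ (x.1, τ)‖) ^ 2 := by
        gcongr
        exact (norm_sum_le _ _).trans (le_of_eq (by simp))
    _ ≤ (∑ τ, ‖U x.2 τ‖ ^ 2) * ∑ τ, ‖ψ (x.1, τ)‖ ^ 2 := Finset.sum_mul_sq_le_sq_mul_sq _ _ _
    _ = _ := mul_comm _ _

/-- The coin operator `I ⊗ U`, that is `|g⟩|τ⟩ ↦ ∑ σ, U σ τ |g⟩|σ⟩`. -/
def coin (U : Matrix S S ℂ) : State G S →ₗ[ℂ] State G S where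
  toFun ψ := ⟨fun x => ∑ τ, U x.2 τ * ψ (x.1, τ), memlp_coin U ψ⟩
  map_add' ψ φ := by
    ext x
    simp [mul_add, Finset.sum_add_distrib]
    rfl
  map_smul' c ψ := by
    ext x
    simp [Finset.mul_sum, mul_left_comm]

theorem memlp_shift [AddGroup G] (ψ : State G S) :
    Memℓp (fun x : G × S => ψ (-(x.2 : G) + x.1, x.2)) 2 := by
  apply memlp_of_summable
  refine (summable_sq ψ).comp_injective
    (i := fun x : G × S => (-(x.2 : G) + x.1, x.2)) ?_
  rintro ⟨g, σ⟩ ⟨h, τ⟩ hx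
  simp only [Prod.mk.injEq] at hx
  obtain ⟨h1, rfl⟩ := hx
  simpa using h1

/-- The translation operator `T : |g⟩|σ⟩ ↦ |σ + g⟩|σ⟩`. -/
def shift [AddGroup G] : State G S →ₗ[ℂ] State G S where
  toFun ψ := ⟨fun x => ψ (-(x.2 : G) + x.1, x.2), memlp_shift ψ⟩
  map_add' ψ φ := by
    ext x
    rfl
  map_smul' c ψ := by
    ext x
    simp

/-- The quantum walk operator `Q = T (I ⊗ U)` of the triple `(G, S, U)`. -/
def walk [AddGroup G] (U : Matrix S S ℂ) : State G S →ₗ[ℂ] State G S :=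
  shift ∘ₗ coin U

theorem memlp_indicator (A : Set (G × S)) (ψ : State G S) :
    Memℓp (A.indicator fun x => ψ x) 2 := by
  apply memlp_of_summable
  refine Summable.of_nonneg_of_le (fun _ => by positivity) (fun x => ?_) (summable_sq ψ)
  gcongr
  exact norm_indicator_le_norm_self _ _

/-- The measurement projection `Π_no^B` onto the closed span of the basis vectors outside `B`. -/
def projNo (B : Set (G × S)) : State G S →ₗ[ℂ] State G S where
  toFun ψ := ⟨Bᶜ.indicator fun x => ψ x, memlp_indicator Bᶜ ψ⟩
  map_add' ψ φ := by
    ext x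
    change Bᶜ.indicator (fun y => ψ y + φ y) x = Bᶜ.indicator _ x + Bᶜ.indicator _ x
    by_cases h : x ∈ B <;> simp [h]
  map_smul' c ψ := by
    ext x
    by_cases h : x ∈ B <;> simp [h]

/-- The absorbing quantum walk operator `Π_no^B Q` of the quadruple `(G, S, U, B)`. -/
def absorbingWalk [AddGroup G] (U : Matrix S S ℂ) (B : Set (G × S)) :
    State G S →ₗ[ℂ] State G S :=
  projNo B ∘ₗ walk U

/-- The probability that the absorbing walk `(G, S, U, B)` started in `ψ` is eventually absorbed
in `B₀ ⊆ B` before it is absorbed in `B \ B₀`, namely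
`∑_{t ≥ 1} ∑_{b ∈ B₀} |⟨b| Q (Π_no^B Q)^(t-1) |ψ⟩|²`. The index `t` below is the `t - 1` of this
formula; the terms and the sums are taken in `[0, ∞]`, where every series has its true value. -/
def absorptionProb [AddGroup G] (U : Matrix S S ℂ) (B B₀ : Set (G × S)) (ψ : State G S) : ℝ≥0∞ :=
  ∑' t : ℕ, ∑' b : B₀, ‖walk U ((absorbingWalk U B ^ t) ψ) (b : G × S)‖ₑ ^ 2

end

/-- The directions of the nearest-neighbour walk on `ℤ`. -/
def C1 : Finset ℤ := {1, -1}

/-- The internal state "right". -/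
def R : C1 := ⟨1, by decide⟩

/-- The internal state "left". -/
def L : C1 := ⟨-1, by decide⟩

/-- The initial state `|m⟩(α|R⟩ + β|L⟩)`. -/
def initState (m : ℤ) (α β : ℂ) : State ℤ C1 :=
  lp.single 2 (m, R) α + lp.single 2 (m, L) β

/-- All basis states located at a position of `A`. -/
def atPos (A : Set ℤ) : Set (ℤ × C1) := {b | b.1 ∈ A}

/-- `P_∞^{(m)}(α, β)`: the probability of eventual absorption at `0`, when `0` is the only
absorbing position. -/
def PInf (U : Matrix C1 C1 ℂ) (m : ℤ) (α β : ℂ) : ℝ≥0∞ :=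
  absorptionProb U (atPos {0}) (atPos {0}) (initState m α β)

/-- `P_n^{(m)}(α, β)`: the probability of eventual absorption at `0` before absorption at `n`,
when the absorbing positions are `0` and `n`. -/
def PFin (U : Matrix C1 C1 ℂ) (n m : ℤ) (α β : ℂ) : ℝ≥0∞ :=
  absorptionProb U (atPos {0, n}) (atPos {0}) (initState m α β)

end QuantumWalk

end

/-! ### Möbius maps of the disc and chains of scatterers -/

noncomputable section

namespace QuantumWalk

open scoped ComplexConjugate
open Filter Topology

/-! After one step from position 1 the left-moving part is absorbed and the rest is a multiple of
`|2⟩|R⟩` (`absorptionProb_initState_one`). So one comparison, for the start `|2⟩|R⟩`, serves all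
coin states, which is why `N` depends on `U` alone. Unless the coin only transmits or only reflects,
it is equivalent to the comparison for the start `|1⟩|R⟩`.

Let `F n` and `f` be the sequences of amplitudes absorbed at 0 in the finite and the semi-infinite
walk from `|1⟩|R⟩`. They agree before the boundary `n` can be felt, so only their tails matter, and
the tail of `f` tends to 0 in `ℓ²`. It suffices that `F n - f` stays away from 0 in `ℓ²`: the tail
of `F n` is then eventually the larger one (`eventually_tsum_sq_le`).

For that bound, `z` times the generating function of `F n` is the `(n - 1)`-st iterate of 0 under a
Möbius map of the disc (`mul_gen_outAmp`), and `z` times that of `f` is a fixed point `w` of the map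
(`mob_mul_gen_outAmp`). On an open set of the circle the map is elliptic: the iterates keep
pseudo-hyperbolic distance `‖w‖` from `w`, so they do not approach it (`le_norm_refl_sub`). Parseval
and Fatou turn this into a bound on coefficients (`sq_mul_measure_le_tsum`). -/

/-- The Möbius map by which the reflection amplitude of a half-line of scatterers changes when one
more scatterer with reflection coefficient `c` and determinant `D` is put in front of it. -/
def mob (c D z w : ℂ) : ℂ := z * (c + D * (z * w)) / (1 + D * conj c * (z * w))

/-- The reflection amplitude of `m` scatterers in a row. -/
def refl (c D : ℂ) : ℕ → ℂ → ℂ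
  | 0, _ => 0
  | m + 1, z => mob c D z (refl c D m z)

section Mobius

variable {c D z w : ℂ}

theorem mob_denom_ne_zero (hc : ‖c‖ < 1) (hD : ‖D‖ = 1) (hz : ‖z‖ ≤ 1) (hw : ‖w‖ ≤ 1) :
    1 + D * conj c * (z * w) ≠ 0 := by
  intro h
  have h1 : D * conj c * (z * w) = -1 := by linear_combination h
  have h2 : ‖D * conj c * (z * w)‖ = 1 := by rw [h1]; simp
  rw [norm_mul, norm_mul, norm_mul, RCLike.norm_conj, hD, one_mul] at h2
  have h3 : ‖z‖ * ‖w‖ ≤ 1 := mul_le_one₀ hz (norm_nonneg _) hw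
  nlinarith [norm_nonneg c, norm_nonneg z, norm_nonneg w]

/-- The matrix of the map scales the Hermitian form `1 - u * conj v`. The diagonal case keeps the
disc invariant; the polarised case gives the invariance of the pseudo-hyperbolic distance. -/
theorem mob_form_identity (hD : ‖D‖ = 1) (u v : ℂ) :
    (1 + D * conj c * u) * conj (1 + D * conj c * v) - (c + D * u) * conj (c + D * v)
      = (1 - c * conj c) * (1 - u * conj v) := by
  have h : D * conj D = 1 := by rw [Complex.mul_conj']; simp [hD]
  simp only [map_add, map_mul, map_one, Complex.conj_conj]
  linear_combination (u * conj v * (c * conj c) - u * conj v) * h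

theorem one_sub_mul_conj_self (c : ℂ) : 1 - c * conj c = ((1 - ‖c‖ ^ 2 : ℝ) : ℂ) := by
  rw [Complex.mul_conj']; push_cast; rfl

theorem norm_mob_le (hc : ‖c‖ < 1) (hD : ‖D‖ = 1) (hz : ‖z‖ ≤ 1) (hw : ‖w‖ ≤ 1) :
    ‖mob c D z w‖ ≤ 1 := by
  have hne := mob_denom_ne_zero hc hD hz hw
  have hzw : ‖z * w‖ ≤ 1 := by rw [norm_mul]; exact mul_le_one₀ hz (norm_nonneg _) hw
  have key := mob_form_identity (c := c) hD (z * w) (z * w)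
  rw [Complex.mul_conj', Complex.mul_conj', one_sub_mul_conj_self, one_sub_mul_conj_self] at key
  norm_cast at key
  have h2 : 0 ≤ (1 - ‖c‖ ^ 2) * (1 - ‖z * w‖ ^ 2) :=
    mul_nonneg (by nlinarith [norm_nonneg c]) (by nlinarith [norm_nonneg (z * w)])
  have h3 : ‖c + D * (z * w)‖ ≤ ‖1 + D * conj c * (z * w)‖ :=
    le_of_sq_le_sq (by linarith) (norm_nonneg _)
  rw [mob, norm_div, norm_mul, div_le_one (norm_pos_iff.2 hne)]
  exact (mul_le_of_le_one_left (norm_nonneg _) hz).trans h3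

theorem norm_refl_le (hc : ‖c‖ < 1) (hD : ‖D‖ = 1) (hz : ‖z‖ ≤ 1) (m : ℕ) :
    ‖refl c D m z‖ ≤ 1 := by
  induction m with
  | zero => simp [refl]
  | succ m ih => exact norm_mob_le hc hD hz ih

theorem continuousOn_refl (hc : ‖c‖ < 1) (hD : ‖D‖ = 1) (m : ℕ) :
    ContinuousOn (refl c D m) (Metric.closedBall 0 1) := by
  induction m with
  | zero => exact continuousOn_const
  | succ m ih =>
    change ContinuousOn (fun z => z * (c + D * (z * refl c D m z)) /
      (1 + D * conj c * (z * refl c D m z))) _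
    refine ContinuousOn.div (by fun_prop) (by fun_prop) fun z hz => ?_
    have hz' : ‖z‖ ≤ 1 := by simpa using hz
    exact mob_denom_ne_zero hc hD hz' (norm_refl_le hc hD hz' m)

/-- For `|z| = 1` the map `mob c D z` preserves the pseudo-hyperbolic distance to a fixed point. -/
theorem norm_mob_sub_eq (hc : ‖c‖ < 1) (hD : ‖D‖ = 1) (hz : ‖z‖ = 1) (hw : ‖w‖ ≤ 1)
    (hfix : mob c D z w = w) {u : ℂ} (hu : ‖u‖ ≤ 1) {k : ℝ}
    (h : ‖u - w‖ = k * ‖1 - u * conj w‖) :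
    ‖mob c D z u - w‖ = k * ‖1 - mob c D z u * conj w‖ := by
  have hnu := mob_denom_ne_zero hc hD hz.le hu
  have hnw := mob_denom_ne_zero hc hD hz.le hw
  have hnw' : conj (1 + D * conj c * (z * w)) ≠ 0 := (map_ne_zero _).2 hnw
  have hzz : z * conj z = 1 := by rw [Complex.mul_conj']; simp [hz]
  have e1 : mob c D z u - w = D * z ^ 2 * (1 - c * conj c) * (u - w) /
      ((1 + D * conj c * (z * u)) * (1 + D * conj c * (z * w))) := by
    conv_lhs => rw [← hfix]
    rw [mob, mob, div_sub_div _ _ hnu hnw]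
    congr 1
    ring
  have e2 : 1 - mob c D z u * conj w = (1 - c * conj c) * (1 - u * conj w) /
      ((1 + D * conj c * (z * u)) * conj (1 + D * conj c * (z * w))) := by
    conv_lhs => rw [← hfix]
    have key := mob_form_identity (c := c) hD (z * u) (z * w)
    rw [mob, mob, map_div₀, div_mul_div_comm, eq_div_iff (mul_ne_zero hnu hnw'), sub_mul,
      div_mul_cancel₀ _ (mul_ne_zero hnu hnw')]
    rw [map_mul _ z w] at key
    rw [map_mul _ z (c + D * (z * w))]
    linear_combination key +
      (-(c + D * (z * u)) * conj (c + D * (z * w)) - (1 - c * conj c) * (u * conj w)) * hzz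
  rw [e1, e2]
  simp only [norm_div, norm_mul, norm_pow, RCLike.norm_conj, hD, hz, h]
  ring

/-- The orbit starts at 0, whose pseudo-hyperbolic distance to `w` is `‖w‖`. The form without
division also admits `‖w‖ = 1`. -/
theorem norm_refl_sub_eq (hc : ‖c‖ < 1) (hD : ‖D‖ = 1) (hz : ‖z‖ = 1) (hw : ‖w‖ ≤ 1)
    (hfix : mob c D z w = w) (m : ℕ) :
    ‖refl c D m z - w‖ = ‖w‖ * ‖1 - refl c D m z * conj w‖ := by
  induction m with
  | zero => simp [refl]
  | succ m ih => exact norm_mob_sub_eq hc hD hz hw hfix (norm_refl_le hc hD hz.le m) ih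

/-- A uniform lower bound for the distance between the reflection amplitudes of finitely and of
infinitely many scatterers, at frequencies `z` inside the transmission band. -/
theorem le_norm_refl_sub (hc : ‖c‖ < 1) (hD : ‖D‖ = 1) (hz : ‖z‖ = 1) (hw : ‖w‖ ≤ 1)
    (hfix : mob c D z w = w) (hband : 1 + ‖c‖ ≤ ‖D * z ^ 2 - 1‖) (m : ℕ) :
    ‖c‖ / 3 * √((1 - ‖c‖) / 3) ≤ ‖refl c D m z - w‖ := by
  have hne := mob_denom_ne_zero hc hD hz.le hw
  -- The fixed-point equation, cleared of its denominator, is quadratic in `w`; both bounds on `‖w‖`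
  -- come from it.
  have hq : z * c = w * (1 - D * z ^ 2) + D * conj c * z * w ^ 2 := by
    rw [mob, div_eq_iff hne] at hfix
    linear_combination hfix
  have h1 : ‖c‖ ≤ ‖w‖ * 2 + ‖c‖ * ‖w‖ ^ 2 := by
    calc ‖c‖ = ‖z * c‖ := by simp [hz]
      _ ≤ ‖w‖ * ‖1 - D * z ^ 2‖ + ‖c‖ * ‖w‖ ^ 2 := by
        rw [hq]
        refine (norm_add_le _ _).trans (le_of_eq ?_)
        simp [hz, hD]
      _ ≤ _ := by
        gcongr
        refine (norm_sub_le _ _).trans (le_of_eq ?_)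
        simp [hz, hD]
        norm_num
  have h2 : ‖w‖ * ‖D * z ^ 2 - 1‖ ≤ ‖c‖ * ‖w‖ ^ 2 + ‖c‖ := by
    have : w * (D * z ^ 2 - 1) = D * conj c * z * w ^ 2 - z * c := by linear_combination hq
    rw [← norm_mul, this]
    refine (norm_sub_le _ _).trans (le_of_eq ?_)
    simp [hz, hD]
  have hw0 := norm_nonneg w
  have hc0 := norm_nonneg c
  have h3 : ‖c‖ / 3 ≤ ‖w‖ := by nlinarith
  -- By `h2` and the band condition, `‖c‖ * (1 - ‖w‖) ^ 2 ≥ ‖w‖ * (1 - ‖c‖)`; then `h3` bounds `‖w‖`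
  -- below and `‖c‖` cancels.
  have h4 : √((1 - ‖c‖) / 3) ≤ 1 - ‖w‖ := by
    refine Real.sqrt_le_iff.2 ⟨by linarith, ?_⟩
    have h5 : ‖w‖ * (1 + ‖c‖) ≤ ‖c‖ * ‖w‖ ^ 2 + ‖c‖ :=
      (mul_le_mul_of_nonneg_left hband hw0).trans h2
    rcases hc0.eq_or_lt with h0 | h0
    · rw [← h0] at h5 ⊢
      have : ‖w‖ = 0 := by nlinarith
      rw [this]; norm_num
    · have h6 : ‖c‖ * ((1 - ‖c‖) / 3) ≤ ‖c‖ * (1 - ‖w‖) ^ 2 := by nlinarith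
      exact le_of_mul_le_mul_left h6 h0
  rw [norm_refl_sub_eq hc hD hz hw hfix m]
  have h7 : 1 - ‖w‖ ≤ ‖1 - refl c D m z * conj w‖ := by
    have h8 : ‖refl c D m z * conj w‖ ≤ ‖w‖ := by
      rw [norm_mul, RCLike.norm_conj]
      exact mul_le_of_le_one_left hw0 (norm_refl_le hc hD hz.le m)
    have := norm_sub_norm_le (1 : ℂ) (refl c D m z * conj w)
    rw [norm_one] at this
    linarith
  exact mul_le_mul h3 (h4.trans h7) (Real.sqrt_nonneg _) hw0

theorem tendsto_mob {ι : Type*} {l : Filter ι} {f g : ι → ℂ} (hc : ‖c‖ < 1) (hD : ‖D‖ = 1)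
    (hz : ‖z‖ ≤ 1) (hw : ‖w‖ ≤ 1) (hf : Tendsto f l (𝓝 z)) (hg : Tendsto g l (𝓝 w)) :
    Tendsto (fun i => mob c D (f i) (g i)) l (𝓝 (mob c D z w)) := by
  refine Tendsto.div ?_ ?_ (mob_denom_ne_zero hc hD hz hw)
  · exact hf.mul (tendsto_const_nhds.add (tendsto_const_nhds.mul (hf.mul hg)))
  · exact tendsto_const_nhds.add (tendsto_const_nhds.mul (hf.mul hg))

end Mobius

end QuantumWalk

end

/-! ### Parseval and Fatou on the circle -/

noncomputable section

namespace QuantumWalk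

open scoped ComplexConjugate
open Filter Topology MeasureTheory AddCircle

section Fourier

variable {T : ℝ}

theorem norm_fourier_apply (n : ℤ) (x : AddCircle T) : ‖fourier n x‖ = 1 := by
  rw [fourier_apply]
  exact Circle.norm_coe _

variable [Fact (0 < T)]

theorem lintegral_sq_sum_fourier (c : ℕ → ℂ) (N : ℕ) :
    ∫⁻ x : AddCircle T, ‖∑ k ∈ Finset.range N, c k * fourier k x‖ₑ ^ 2 ∂haarAddCircle
      = ∑ k ∈ Finset.range N, ‖c k‖ₑ ^ 2 := by
  let p : C(AddCircle T, ℂ) := ∑ k ∈ Finset.range N, c k • fourier (k : ℤ)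
  have hp : ∀ x, ∑ k ∈ Finset.range N, c k * fourier (k : ℤ) x = p x := fun x => by
    simp [p, ContinuousMap.sum_apply]
  have hLp : ContinuousMap.toLp (E := ℂ) 2 haarAddCircle ℂ p
      = ∑ k ∈ Finset.range N, c k • fourierLp (T := T) 2 (k : ℤ) := by
    simp only [p, map_sum, map_smul, fourierLp]
  have ho : Orthonormal ℂ fun k : ℕ => fourierLp (T := T) 2 (k : ℤ) :=
    orthonormal_fourier.comp _ Nat.cast_injective
  have h1 := ho.inner_sum c c (Finset.range N)
  rw [← hLp, ContinuousMap.inner_toLp] at h1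
  have h2 : ∀ z : ℂ, z * conj z = ((‖z‖ ^ 2 : ℝ) : ℂ) := fun z => by
    rw [Complex.mul_conj']; push_cast; rfl
  have h3 : ∀ z : ℂ, conj z * z = ((‖z‖ ^ 2 : ℝ) : ℂ) := fun z => by rw [mul_comm, h2]
  simp only [h2, h3] at h1
  rw [integral_complex_ofReal] at h1
  norm_cast at h1
  have h4 : Integrable (fun x => ‖p x‖ ^ 2) (haarAddCircle (T := T)) :=
    (by fun_prop : Continuous fun x => ‖p x‖ ^ 2).integrable_of_hasCompactSupport
      (HasCompactSupport.of_compactSpace _)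
  have h5 : ∀ z : ℂ, ‖z‖ₑ ^ 2 = ENNReal.ofReal (‖z‖ ^ 2) := fun z => by
    rw [ENNReal.ofReal_pow (norm_nonneg _), ofReal_norm]
  simp only [hp, h5]
  rw [← ofReal_integral_eq_lintegral_ofReal h4 (ae_of_all _ fun x => by positivity), h1,
    ENNReal.ofReal_sum_of_nonneg fun _ _ => by positivity]

/-- Fatou applied to the partial sums; this half of Parseval's identity is all that is needed. -/
theorem lintegral_sq_tsum_fourier_le {c : ℕ → ℂ} (hc : Summable fun k => ‖c k‖) :
    ∫⁻ x : AddCircle T, ‖∑' k : ℕ, c k * fourier k x‖ₑ ^ 2 ∂haarAddCircle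
      ≤ ∑' k, ‖c k‖ₑ ^ 2 := by
  have hlim : ∀ x : AddCircle T, Tendsto
      (fun N => ‖∑ k ∈ Finset.range N, c k * fourier k x‖ₑ ^ 2) atTop
      (𝓝 (‖∑' k : ℕ, c k * fourier k x‖ₑ ^ 2)) := fun x => by
    have hs : Summable fun k : ℕ => c k * fourier (k : ℤ) x :=
      Summable.of_norm (by simpa [norm_fourier_apply, -fourier_apply] using hc)
    exact (ENNReal.continuous_pow 2).continuousAt.tendsto.comp
      (continuous_enorm.continuousAt.tendsto.comp hs.hasSum.tendsto_sum_nat)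
  calc _ = ∫⁻ x : AddCircle T, liminf (fun N => ‖∑ k ∈ Finset.range N, c k * fourier k x‖ₑ ^ 2)
          atTop ∂haarAddCircle := by
        congr with x
        exact (hlim x).liminf_eq.symm
    _ ≤ liminf (fun N => ∫⁻ x : AddCircle T,
          ‖∑ k ∈ Finset.range N, c k * fourier k x‖ₑ ^ 2 ∂haarAddCircle) atTop := by
        refine lintegral_liminf_le fun N => ?_
        fun_prop
    _ ≤ ∑' k, ‖c k‖ₑ ^ 2 := by
        simp only [lintegral_sq_sum_fourier]
        exact liminf_le_of_le (by isBoundedDefault) fun b hb => by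
          obtain ⟨N, hN⟩ := hb.exists
          exact hN.trans (ENNReal.sum_le_tsum _)

/-- If the radial values of a power series are eventually at least `κ` at every point of an open
set of the circle, then its coefficients have a large square sum. -/
theorem sq_mul_measure_le_tsum {h : ℕ → ℂ} {C : ℝ} (hC : ∀ k, ‖h k‖ ≤ C) {ρ : ℕ → ℝ}
    (h0 : ∀ j, 0 ≤ ρ j) (h1 : ∀ j, ρ j < 1) {S : Set (AddCircle T)} (hS : IsOpen S) {κ : ℝ≥0∞}
    (hκ : ∀ x ∈ S, ∀ᶠ j in atTop, κ ≤ ‖∑' k, h k * (ρ j * fourier 1 x) ^ k‖ₑ) :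
    κ ^ 2 * haarAddCircle S ≤ ∑' k, ‖h k‖ₑ ^ 2 := by
  have hf : ∀ j (x : AddCircle T),
      ∑' k, h k * (ρ j * fourier 1 x) ^ k = ∑' k : ℕ, (h k * ρ j ^ k) * fourier k x := by
    intro j x
    congr with k
    rw [mul_pow, mul_assoc]
    congr 2
    simp [fourier_apply, toCircle_nsmul]
  have hsum : ∀ j, Summable fun k => ‖h k * (ρ j : ℂ) ^ k‖ := by
    intro j
    refine Summable.of_nonneg_of_le (fun _ => norm_nonneg _) (fun k => ?_)
      ((summable_geometric_of_lt_one (h0 j) (h1 j)).mul_left C)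
    rw [norm_mul, norm_pow, Complex.norm_real, Real.norm_of_nonneg (h0 j)]
    exact mul_le_mul_of_nonneg_right (hC k) (pow_nonneg (h0 j) k)
  have hcont : ∀ j, Continuous fun x : AddCircle T =>
      ∑' k : ℕ, (h k * (ρ j : ℂ) ^ k) * fourier k x := by
    intro j
    refine continuous_tsum (fun k => by fun_prop) (hsum j) fun k x => ?_
    simp [norm_fourier_apply, -fourier_apply]
  have hle : ∀ j, ∫⁻ x : AddCircle T, ‖∑' k : ℕ, (h k * (ρ j : ℂ) ^ k) * fourier k x‖ₑ ^ 2
      ∂haarAddCircle ≤ ∑' k, ‖h k‖ₑ ^ 2 := by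
    intro j
    refine (lintegral_sq_tsum_fourier_le (hsum j)).trans (ENNReal.tsum_le_tsum fun k => ?_)
    gcongr
    rw [enorm_mul]
    refine mul_le_of_le_one_right' ?_
    rw [← ofReal_norm, norm_pow, Complex.norm_real, Real.norm_of_nonneg (h0 j)]
    exact ENNReal.ofReal_le_one.2 (pow_le_one₀ (h0 j) (h1 j).le)
  calc κ ^ 2 * haarAddCircle S = ∫⁻ x, S.indicator (fun _ => κ ^ 2) x ∂haarAddCircle := by
        rw [lintegral_indicator_const hS.measurableSet]
    -- Working with the lower limit over radii avoids the existence of boundary values.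
    _ ≤ ∫⁻ x : AddCircle T, liminf
          (fun j => ‖∑' k : ℕ, (h k * (ρ j : ℂ) ^ k) * fourier k x‖ₑ ^ 2) atTop
          ∂haarAddCircle := by
        refine lintegral_mono fun x => ?_
        by_cases hx : x ∈ S
        · rw [Set.indicator_of_mem hx]
          refine le_liminf_of_le (by isBoundedDefault) ?_
          filter_upwards [hκ x hx] with j hj
          rw [← hf]
          gcongr
        · simp [hx]
    _ ≤ liminf (fun j => ∫⁻ x : AddCircle T,
          ‖∑' k : ℕ, (h k * (ρ j : ℂ) ^ k) * fourier k x‖ₑ ^ 2 ∂haarAddCircle) atTop :=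
        lintegral_liminf_le fun j => by
          have := (hcont j).measurable
          fun_prop
    _ ≤ ∑' k, ‖h k‖ₑ ^ 2 :=
        liminf_le_of_le (by isBoundedDefault) fun b hb => by
          obtain ⟨j, hj⟩ := hb.exists
          exact hj.trans (hle j)

end Fourier

end QuantumWalk

end

/-! ### Steps of the absorbing walk -/

noncomputable section

namespace QuantumWalk

open scoped ComplexConjugate
open Filter Topology

theorem sum_C1 {M : Type*} [AddCommMonoid M] (f : C1 → M) : ∑ τ, f τ = f R + f L := by
  have h : (Finset.univ : Finset C1) = {R, L} := by decide
  rw [h, Finset.sum_pair (by decide)]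

theorem forall_C1 {p : C1 → Prop} : (∀ σ, p σ) ↔ p R ∧ p L := by
  refine ⟨fun h => ⟨h R, h L⟩, fun h σ => ?_⟩
  have : σ = R ∨ σ = L := by revert σ; decide
  rcases this with rfl | rfl
  exacts [h.1, h.2]

section Step

variable (U : Matrix C1 C1 ℂ) (ψ : State ℤ C1)

theorem walk_apply_R (x : ℤ) :
    walk U ψ (x, R) = U R R * ψ (x - 1, R) + U R L * ψ (x - 1, L) := by
  change ∑ τ, U R τ * ψ (-1 + x, τ) = _
  rw [sum_C1, neg_add_eq_sub]

theorem walk_apply_L (x : ℤ) :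
    walk U ψ (x, L) = U L R * ψ (x + 1, R) + U L L * ψ (x + 1, L) := by
  change ∑ τ, U L τ * ψ (- -1 + x, τ) = _
  rw [sum_C1, neg_neg, add_comm 1 x]

variable {B : Set ℤ} {x : ℤ}

theorem absorbingWalk_apply_of_mem (hx : x ∈ B) (σ : C1) :
    absorbingWalk U (atPos B) ψ (x, σ) = 0 :=
  Set.indicator_of_notMem (s := (atPos B)ᶜ) (fun h => h hx) _

theorem absorbingWalk_apply_of_notMem (hx : x ∉ B) (σ : C1) :
    absorbingWalk U (atPos B) ψ (x, σ) = walk U ψ (x, σ) :=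
  Set.indicator_of_mem (s := (atPos B)ᶜ) hx _

end Step

/-- The state of the walk absorbed in `B` after `t` steps. -/
def evolve (U : Matrix C1 C1 ℂ) (B : Set ℤ) (ψ : State ℤ C1) (t : ℕ) : State ℤ C1 :=
  (absorbingWalk U (atPos B) ^ t) ψ

/-- The amplitude with which the walk is absorbed at `0` in step `t + 1`, coming from the right. -/
def outAmp (U : Matrix C1 C1 ℂ) (B : Set ℤ) (ψ : State ℤ C1) (t : ℕ) : ℂ :=
  walk U (evolve U B ψ t) (0, L)

section Evolve

variable {U : Matrix C1 C1 ℂ} {B : Set ℤ} {ψ : State ℤ C1}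

@[simp]
theorem evolve_zero : evolve U B ψ 0 = ψ := rfl

theorem evolve_succ (t : ℕ) :
    evolve U B ψ (t + 1) = absorbingWalk U (atPos B) (evolve U B ψ t) := by
  rw [evolve, pow_succ', Module.End.mul_apply]
  rfl

theorem evolve_succ' (t : ℕ) :
    evolve U B ψ (t + 1) = evolve U B (absorbingWalk U (atPos B) ψ) t := by
  rw [evolve, pow_succ, Module.End.mul_apply]
  rfl

theorem outAmp_eq (t : ℕ) : outAmp U B ψ t =
    U L R * evolve U B ψ t (1, R) + U L L * evolve U B ψ t (1, L) := by
  rw [outAmp, walk_apply_L]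
  rfl

theorem evolve_apply_of_mem {x : ℤ} {σ : C1} (hx : x ∈ B) (h0 : ψ (x, σ) = 0) (t : ℕ) :
    evolve U B ψ t (x, σ) = 0 := by
  cases t with
  | zero => exact h0
  | succ t => rw [evolve_succ, absorbingWalk_apply_of_mem _ _ hx]

theorem evolve_apply_nonpos (hB : 0 ∈ B) (hψ : ∀ x ≤ 0, ∀ σ, ψ (x, σ) = 0) (t : ℕ) :
    ∀ x ≤ 0, ∀ σ, evolve U B ψ t (x, σ) = 0 := by
  induction t with
  | zero => exact hψ
  | succ t ih =>
    intro x hx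
    by_cases hxB : x ∈ B
    · exact fun σ => evolve_apply_of_mem hxB (hψ x hx σ) _
    · have hx0 : x ≠ 0 := fun h => hxB (h ▸ hB)
      rw [forall_C1, evolve_succ, absorbingWalk_apply_of_notMem _ _ hxB,
        absorbingWalk_apply_of_notMem _ _ hxB, walk_apply_R, walk_apply_L,
        ih _ (by omega), ih _ (by omega), ih _ (by omega), ih _ (by omega)]
      simp

/-- The walk never lives at a position `≤ 0`, so nothing reaches 0 moving right. -/
theorem absorptionProb_eq_tsum (hB : 0 ∈ B) (hψ : ∀ x ≤ 0, ∀ σ, ψ (x, σ) = 0) :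
    absorptionProb U (atPos B) (atPos {0}) ψ = ∑' t, ‖outAmp U B ψ t‖ₑ ^ 2 := by
  rw [absorptionProb]
  congr with t
  rw [tsum_eq_single (⟨(0, L), rfl⟩ : atPos {0})]
  · rfl
  · rintro ⟨⟨x, σ⟩, hx⟩ hne
    obtain rfl : x = 0 := hx
    revert hne
    revert σ
    rw [forall_C1]
    refine ⟨fun _ => ?_, fun h => absurd rfl h⟩
    have h0 := evolve_apply_nonpos (U := U) hB hψ t
    change ‖walk U (evolve U B ψ t) (0, R)‖ₑ ^ 2 = 0
    rw [walk_apply_R, h0 _ (by omega), h0 _ (by omega)]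
    simp

end Evolve

/-! ### Decomposition after the first step -/

section FirstStep

theorem initState_apply (m x : ℤ) (α β : ℂ) :
    initState m α β (x, R) = (if x = m then α else 0) ∧
      initState m α β (x, L) = (if x = m then β else 0) := by
  have hne : R ≠ L := by decide
  constructor
  · change (lp.single 2 (m, R) α : State ℤ C1) (x, R) + (lp.single 2 (m, L) β : State ℤ C1) (x, R)
      = _
    simp [lp.single_apply, Pi.single_apply, hne]
  · change (lp.single 2 (m, R) α : State ℤ C1) (x, L) + (lp.single 2 (m, L) β : State ℤ C1) (x, L)
      = _
    simp [lp.single_apply, Pi.single_apply, hne.symm]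

theorem initState_apply_R (m x : ℤ) (α β : ℂ) :
    initState m α β (x, R) = if x = m then α else 0 := (initState_apply m x α β).1

theorem initState_apply_L (m x : ℤ) (α β : ℂ) :
    initState m α β (x, L) = if x = m then β else 0 := (initState_apply m x α β).2

theorem initState_apply_nonpos {m : ℤ} (hm : 0 < m) (α β : ℂ) :
    ∀ x ≤ 0, ∀ σ, initState m α β (x, σ) = 0 := by
  intro x hx
  rw [forall_C1, initState_apply_R, initState_apply_L]
  simp only [if_neg (show ¬ x = m by omega), and_self]

variable {U : Matrix C1 C1 ℂ} {B : Set ℤ}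

theorem absorbingWalk_initState_one (h0 : 0 ∈ B) (h2 : 2 ∉ B) (α β : ℂ) :
    absorbingWalk U (atPos B) (initState 1 α β) =
      (U R R * α + U R L * β) • initState 2 1 0 := by
  ext ⟨x, σ⟩
  rw [lp.coeFn_smul, Pi.smul_apply, smul_eq_mul]
  revert σ
  rw [forall_C1, initState_apply_R, initState_apply_L]
  by_cases hx : x ∈ B
  · have : x ≠ 2 := fun h => h2 (h ▸ hx)
    simp [absorbingWalk_apply_of_mem _ _ hx, this]
  · have : x ≠ 0 := fun h => hx (h ▸ h0)
    rw [absorbingWalk_apply_of_notMem _ _ hx, absorbingWalk_apply_of_notMem _ _ hx, walk_apply_R,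
      walk_apply_L, initState_apply_R, initState_apply_L, initState_apply_R, initState_apply_L,
      if_neg (show ¬ x + 1 = 1 by omega), if_neg (show ¬ x + 1 = 1 by omega)]
    by_cases hx2 : x = 2
    · simp [hx2]
    · simp [hx2, show ¬ x - 1 = 1 by omega]

/-- After the first step the part of the walk that moved left is absorbed, hence the absorption
probability is a sum without interference. -/
theorem absorptionProb_initState_one (h0 : 0 ∈ B) (h2 : 2 ∉ B) (α β : ℂ) :
    absorptionProb U (atPos B) (atPos {0}) (initState 1 α β) =
      ‖U L R * α + U L L * β‖ₑ ^ 2 + ‖U R R * α + U R L * β‖ₑ ^ 2 *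
        absorptionProb U (atPos B) (atPos {0}) (initState 2 1 0) := by
  rw [absorptionProb_eq_tsum h0 (initState_apply_nonpos one_pos α β),
    absorptionProb_eq_tsum h0 (initState_apply_nonpos two_pos 1 0),
    tsum_eq_zero_add' ENNReal.summable, ← ENNReal.tsum_mul_left]
  congr 1
  · rw [outAmp_eq, evolve_zero, initState_apply_R, initState_apply_L]
    simp
  · congr with t
    rw [outAmp_eq, evolve_succ', absorbingWalk_initState_one h0 h2, evolve, map_smul, ← evolve,
      outAmp_eq, lp.coeFn_smul, Pi.smul_apply, Pi.smul_apply, smul_eq_mul, smul_eq_mul,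
      ← mul_pow, ← enorm_mul]
    congr 2
    ring

end FirstStep

/-! ### Unitarity and conservation of norm -/

section Energy

/-- The squared norm of a state. -/
def energy (ψ : State ℤ C1) : ℝ≥0∞ := ∑' x, ‖ψ x‖ₑ ^ 2

theorem energy_eq (ψ : State ℤ C1) :
    energy ψ = ∑' x : ℤ, ‖ψ (x, R)‖ₑ ^ 2 + ∑' x : ℤ, ‖ψ (x, L)‖ₑ ^ 2 := by
  rw [energy, ENNReal.tsum_prod (f := fun x σ => ‖ψ (x, σ)‖ₑ ^ 2), ← ENNReal.tsum_add]
  congr with x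
  rw [tsum_fintype, sum_C1]

theorem enorm_sq_eq_ofReal (z : ℂ) : ‖z‖ₑ ^ 2 = ENNReal.ofReal (‖z‖ ^ 2) := by
  rw [ENNReal.ofReal_pow (norm_nonneg _), ofReal_norm]

/-- The entries of a unitary coin, in terms of its first column and its determinant. -/
theorem unitary_entries {U : Matrix C1 C1 ℂ} (hU : U ∈ Matrix.unitaryGroup C1 ℂ) :
    ∃ D : ℂ, ‖D‖ = 1 ∧ U R L = -D * conj (U L R) ∧ U L L = D * conj (U R R) ∧
      ‖U R R‖ ^ 2 + ‖U L R‖ ^ 2 = 1 := by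
  have h := Matrix.mem_unitaryGroup_iff'.1 hU
  have hRR := congrFun (congrFun h R) R
  have hRL := congrFun (congrFun h R) L
  have hLL := congrFun (congrFun h L) L
  simp only [Matrix.mul_apply, Matrix.star_apply, sum_C1, Matrix.one_apply,
    if_neg (show R ≠ L by decide), if_true, RCLike.star_def] at hRR hRL hLL
  -- `D` will be the determinant; orthonormality of the columns expresses the second column through
  -- it.
  have e1 : U R L = -(U R R * U L L - U R L * U L R) * conj (U L R) := by
    linear_combination U R R * hRL - U R L * hRR
  have e2 : U L L = (U R R * U L L - U R L * U L R) * conj (U R R) := by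
    linear_combination U L R * hRL - U L L * hRR
  generalize U R R * U L L - U R L * U L R = D at e1 e2
  have hn : ‖U R R‖ ^ 2 + ‖U L R‖ ^ 2 = 1 := by
    rw [Complex.conj_mul', Complex.conj_mul'] at hRR
    exact_mod_cast hRR
  refine ⟨D, ?_, e1, e2, hn⟩
  rw [Complex.conj_mul', Complex.conj_mul', e1, e2, norm_mul, norm_mul, norm_neg,
    RCLike.norm_conj, RCLike.norm_conj] at hLL
  norm_cast at hLL
  have : ‖D‖ ^ 2 = 1 := by linear_combination hLL - ‖D‖ ^ 2 * hn
  exact (pow_eq_one_iff_of_nonneg (norm_nonneg D) two_ne_zero).1 this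

theorem coin_norm_sq {U : Matrix C1 C1 ℂ} (hU : U ∈ Matrix.unitaryGroup C1 ℂ) (p q : ℂ) :
    ‖U R R * p + U R L * q‖ₑ ^ 2 + ‖U L R * p + U L L * q‖ₑ ^ 2 = ‖p‖ₑ ^ 2 + ‖q‖ₑ ^ 2 := by
  obtain ⟨D, hD, hb, hd, hn⟩ := unitary_entries hU
  have hD' : D * conj D = 1 := by rw [Complex.mul_conj']; simp [hD]
  have hn' : U R R * conj (U R R) + U L R * conj (U L R) = 1 := by
    rw [Complex.mul_conj', Complex.mul_conj']
    exact_mod_cast hn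
  simp only [enorm_sq_eq_ofReal]
  rw [← ENNReal.ofReal_add (by positivity) (by positivity),
    ← ENNReal.ofReal_add (by positivity) (by positivity)]
  congr 1
  rw [← Complex.ofReal_inj]
  push_cast
  simp only [← Complex.mul_conj', hb, hd, map_add, map_mul, map_neg, Complex.conj_conj]
  linear_combination (p * conj p + q * conj q) * hn' +
    q * conj q * (U R R * conj (U R R) + U L R * conj (U L R)) * hD'

theorem energy_walk {U : Matrix C1 C1 ℂ} (hU : U ∈ Matrix.unitaryGroup C1 ℂ) (ψ : State ℤ C1) :
    energy (walk U ψ) = energy ψ := by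
  rw [energy_eq, energy_eq]
  simp only [walk_apply_R, walk_apply_L]
  have hR := (Equiv.subRight (1 : ℤ)).tsum_eq
    fun x => ‖U R R * ψ (x, R) + U R L * ψ (x, L)‖ₑ ^ 2
  have hL := (Equiv.addRight (1 : ℤ)).tsum_eq
    fun x => ‖U L R * ψ (x, R) + U L L * ψ (x, L)‖ₑ ^ 2
  simp only [Equiv.subRight_apply, Equiv.coe_addRight] at hR hL
  rw [hR, hL, ← ENNReal.tsum_add, ← ENNReal.tsum_add]
  congr with x
  exact coin_norm_sq hU _ _

variable {U : Matrix C1 C1 ℂ} {B : Set ℤ} {ψ : State ℤ C1}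

/-- The projection removes at least the component at `(0, L)`; what it removes elsewhere in `B` is
not counted. -/
theorem energy_absorbingWalk_add_le (hU : U ∈ Matrix.unitaryGroup C1 ℂ) (h0 : 0 ∈ B)
    (ψ : State ℤ C1) :
    energy (absorbingWalk U (atPos B) ψ) + ‖walk U ψ (0, L)‖ₑ ^ 2 ≤ energy ψ := by
  rw [← energy_walk hU ψ]
  rw [← tsum_ite_eq ((0, L) : ℤ × C1) (fun _ => ‖walk U ψ (0, L)‖ₑ ^ 2), energy, energy,
    ← ENNReal.tsum_add]
  refine ENNReal.tsum_le_tsum fun ⟨x, σ⟩ => ?_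
  by_cases hx : x ∈ B
  · rw [absorbingWalk_apply_of_mem _ _ hx]
    split_ifs with h
    · simp [h]
    · simp
  · rw [absorbingWalk_apply_of_notMem _ _ hx, if_neg, add_zero]
    intro h
    exact hx ((Prod.mk.inj h).1 ▸ h0)

theorem sum_outAmp_add_energy_le (hU : U ∈ Matrix.unitaryGroup C1 ℂ) (h0 : 0 ∈ B) (t : ℕ) :
    ∑ s ∈ Finset.range t, ‖outAmp U B ψ s‖ₑ ^ 2 + energy (evolve U B ψ t) ≤ energy ψ := by
  induction t with
  | zero => simp
  | succ t ih =>
    refine le_trans ?_ ih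
    rw [Finset.sum_range_succ, add_assoc, evolve_succ, add_comm (‖_‖ₑ ^ 2)]
    gcongr
    exact energy_absorbingWalk_add_le hU h0 _

/-- This makes absorption probabilities finite and bounds the amplitudes, so that their generating
functions converge in the open disc. -/
theorem tsum_outAmp_le (hU : U ∈ Matrix.unitaryGroup C1 ℂ) (h0 : 0 ∈ B) :
    ∑' t, ‖outAmp U B ψ t‖ₑ ^ 2 ≤ energy ψ := by
  rw [ENNReal.tsum_eq_iSup_nat]
  exact iSup_le fun t => le_self_add.trans (sum_outAmp_add_energy_le hU h0 t)

theorem norm_le_one_of_enorm_sq_le {z : ℂ} (h : ‖z‖ₑ ^ 2 ≤ 1) : ‖z‖ ≤ 1 := by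
  rw [enorm_sq_eq_ofReal, ENNReal.ofReal_le_one] at h
  nlinarith [norm_nonneg z]

theorem norm_evolve_apply_le (hU : U ∈ Matrix.unitaryGroup C1 ℂ) (h0 : 0 ∈ B)
    (hψ : energy ψ ≤ 1) (t : ℕ) (x : ℤ × C1) : ‖evolve U B ψ t x‖ ≤ 1 :=
  norm_le_one_of_enorm_sq_le <|
    ((ENNReal.le_tsum x).trans (le_add_self.trans (sum_outAmp_add_energy_le hU h0 t))).trans hψ

theorem norm_outAmp_le (hU : U ∈ Matrix.unitaryGroup C1 ℂ) (h0 : 0 ∈ B)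
    (hψ : energy ψ ≤ 1) (t : ℕ) : ‖outAmp U B ψ t‖ ≤ 1 :=
  norm_le_one_of_enorm_sq_le <| ((ENNReal.le_tsum t).trans (tsum_outAmp_le hU h0)).trans hψ

theorem energy_initState_one_zero (m : ℤ) : energy (initState m 1 0) = 1 := by
  rw [energy_eq]
  simp only [initState_apply_R, initState_apply_L]
  rw [tsum_eq_single m (fun x hx => by simp [hx])]
  simp

end Energy

end QuantumWalk

end

/-! ### Generating functions of amplitudes -/

noncomputable section

namespace QuantumWalk

open scoped ComplexConjugate
open Filter Topology MeasureTheory AddCircle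

/-- The generating function of a sequence of amplitudes. -/
def gen (f : ℕ → ℂ) (z : ℂ) : ℂ := ∑' t, f t * z ^ t

section Gen

variable {f g : ℕ → ℂ} {z : ℂ}

theorem summable_gen (hf : ∀ t, ‖f t‖ ≤ 1) (hz : ‖z‖ < 1) : Summable fun t => f t * z ^ t := by
  refine Summable.of_norm_bounded (summable_geometric_of_lt_one (norm_nonneg z) hz) fun t => ?_
  rw [norm_mul, norm_pow]
  exact mul_le_of_le_one_left (by positivity) (hf t)

theorem gen_sub (hf : ∀ t, ‖f t‖ ≤ 1) (hg : ∀ t, ‖g t‖ ≤ 1) (hz : ‖z‖ < 1) :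
    gen (fun t => f t - g t) z = gen f z - gen g z := by
  rw [gen, gen, gen, ← (summable_gen hf hz).tsum_sub (summable_gen hg hz)]
  congr with t
  ring

theorem gen_linear (hf : ∀ t, ‖f t‖ ≤ 1) (hg : ∀ t, ‖g t‖ ≤ 1) (hz : ‖z‖ < 1) (p q : ℂ) :
    gen (fun t => p * f t + q * g t) z = p * gen f z + q * gen g z := by
  rw [gen, gen, gen, ← tsum_mul_left, ← tsum_mul_left,
    ← ((summable_gen hf hz).mul_left p).tsum_add ((summable_gen hg hz).mul_left q)]
  congr with t
  ring

theorem gen_succ (hf : ∀ t, ‖f t‖ ≤ 1) (hz : ‖z‖ < 1) :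
    gen f z = f 0 + z * gen (fun t => f (t + 1)) z := by
  rw [gen, gen, (summable_gen hf hz).tsum_eq_zero_add, ← tsum_mul_left]
  congr 1
  · simp
  · congr with t
    ring

theorem tendsto_gen {F : ℕ → ℕ → ℂ} (hF : ∀ n t, ‖F n t‖ ≤ 1)
    (h : ∀ t, ∀ᶠ n in atTop, F n t = f t) (hz : ‖z‖ < 1) :
    Tendsto (fun n => gen (F n) z) atTop (𝓝 (gen f z)) := by
  refine tendsto_tsum_of_dominated_convergence
    (summable_geometric_of_lt_one (norm_nonneg z) hz) (fun t => ?_) (Eventually.of_forall ?_)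
  · exact tendsto_nhds_of_eventually_eq ((h t).mono fun n hn => by rw [hn])
  · intro n t
    rw [norm_mul, norm_pow]
    exact mul_le_of_le_one_left (by positivity) (hF n t)

end Gen

theorem notMem_pair {x n : ℤ} (h0 : x ≠ 0) (hn : x ≠ n) : x ∉ ({0, n} : Set ℤ) := by
  simp [h0, hn]

/-! ### Generating functions as reflection amplitudes -/

section Reflection

variable {U : Matrix C1 C1 ℂ} {c D z : ℂ}

/-- Adding one site: `p` and `q` are the right- and left-moving waves there, and everything behind
it reflects with amplitude `r`. Eliminating `q` gives the reflected wave. -/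
theorem mob_of_scattering {a b d r p q : ℂ} (hb : b = -D * conj c) (had : a * d - b * c = D)
    (hne : 1 + D * conj c * (z * r) ≠ 0) (hq : q = r * (z * (a * p + b * q))) :
    z * (c * p + d * q) = mob c D z r * p := by
  rw [mob, div_mul_eq_mul_div, eq_div_iff hne]
  have h1 : q * (1 + D * conj c * (z * r)) = a * z * r * p := by
    linear_combination hq + q * z * r * hb
  linear_combination z * d * h1 + z ^ 2 * r * p * had + z ^ 2 * r * c * p * hb

theorem det_eq {a b d : ℂ} (hb : b = -D * conj c) (hd : d = D * conj a)
    (hn : ‖a‖ ^ 2 + ‖c‖ ^ 2 = 1) : a * d - b * c = D := by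
  have hn' : a * conj a + c * conj c = 1 := by
    rw [Complex.mul_conj', Complex.mul_conj']
    exact_mod_cast hn
  rw [hb, hd]
  linear_combination D * hn'

theorem gen_evolve_R (hU : U ∈ Matrix.unitaryGroup C1 ℂ) {B : Set ℤ} (h0 : 0 ∈ B)
    {ψ : State ℤ C1} (hψ : energy ψ ≤ 1) (hz : ‖z‖ < 1) {x : ℤ} (hx : x ∉ B) :
    gen (fun t => evolve U B ψ t (x, R)) z = ψ (x, R) + z *
      (U R R * gen (fun t => evolve U B ψ t (x - 1, R)) z +
        U R L * gen (fun t => evolve U B ψ t (x - 1, L)) z) := by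
  have hbd := fun t y => norm_evolve_apply_le (U := U) hU h0 hψ t y
  rw [gen_succ (fun t => hbd t _) hz, ← gen_linear (fun t => hbd t _) (fun t => hbd t _) hz]
  simp only [evolve_succ, absorbingWalk_apply_of_notMem _ _ hx, walk_apply_R, evolve_zero]

theorem gen_evolve_L (hU : U ∈ Matrix.unitaryGroup C1 ℂ) {B : Set ℤ} (h0 : 0 ∈ B)
    {ψ : State ℤ C1} (hψ : energy ψ ≤ 1) (hz : ‖z‖ < 1) {x : ℤ} (hx : x ∉ B) :
    gen (fun t => evolve U B ψ t (x, L)) z = ψ (x, L) + z *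
      (U L R * gen (fun t => evolve U B ψ t (x + 1, R)) z +
        U L L * gen (fun t => evolve U B ψ t (x + 1, L)) z) := by
  have hbd := fun t y => norm_evolve_apply_le (U := U) hU h0 hψ t y
  rw [gen_succ (fun t => hbd t _) hz, ← gen_linear (fun t => hbd t _) (fun t => hbd t _) hz]
  simp only [evolve_succ, absorbingWalk_apply_of_notMem _ _ hx, walk_apply_L, evolve_zero]

theorem gen_evolve_of_mem {B : Set ℤ} {ψ : State ℤ C1} {x : ℤ} {σ : C1} (hx : x ∈ B)
    (h0 : ψ (x, σ) = 0) : gen (fun t => evolve U B ψ t (x, σ)) z = 0 := by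
  simp [gen, evolve_apply_of_mem hx h0]

/-- In the walk between `0` and `n`, the sites to the right of `x` act as a chain of scatterers. -/
theorem gen_evolve_L_eq_refl (hU : U ∈ Matrix.unitaryGroup C1 ℂ) (hc : ‖U L R‖ < 1)
    (hD : ‖D‖ = 1) (hb : U R L = -D * conj (U L R)) (hd : U L L = D * conj (U R R))
    (hn : ‖U R R‖ ^ 2 + ‖U L R‖ ^ 2 = 1) (hz : ‖z‖ < 1) {n : ℕ} (m : ℕ) :
    ∀ x : ℤ, 1 ≤ x → x + m + 1 = n →
      gen (fun t => evolve U {0, (n : ℤ)} (initState 1 1 0) t (x, L)) z =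
        refl (U L R) D m z *
          (z * (U R R * gen (fun t => evolve U {0, (n : ℤ)} (initState 1 1 0) t (x, R)) z +
            U R L * gen (fun t => evolve U {0, (n : ℤ)} (initState 1 1 0) t (x, L)) z)) := by
  have h0 : (0 : ℤ) ∈ ({0, (n : ℤ)} : Set ℤ) := by simp
  have hψ := (energy_initState_one_zero 1).le
  induction m with
  | zero =>
    -- Here `x + 1 = n` absorbs, so nothing comes back: the reflection amplitude is 0.
    intro x hx hxn
    have hxB : x ∉ ({0, (n : ℤ)} : Set ℤ) := notMem_pair (by omega) (by omega)
    have hxB' : x + 1 ∈ ({0, (n : ℤ)} : Set ℤ) :=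
      Or.inr (Set.mem_singleton_iff.2 (by simpa using hxn))
    rw [gen_evolve_L hU h0 hψ hz hxB, gen_evolve_of_mem hxB', gen_evolve_of_mem hxB',
      initState_apply_L]
    · simp [refl]
    · rw [initState_apply_L, if_neg (by omega)]
    · rw [initState_apply_R, if_neg (by omega)]
  | succ m ih =>
    intro x hx hxn
    have hxB : ∀ y : ℤ, 1 ≤ y → y < n → y ∉ ({0, (n : ℤ)} : Set ℤ) := fun y hy hyn =>
      notMem_pair (by omega) (by omega)
    have hL := ih (x + 1) (by omega) (by push_cast at hxn; omega)
    have hne := mob_denom_ne_zero hc hD hz.le (norm_refl_le hc hD hz.le m)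
    have hR := gen_evolve_R hU h0 hψ hz (hxB (x + 1) (by omega) (by omega))
    rw [initState_apply_R, if_neg (by omega), zero_add, add_sub_cancel_right] at hR
    -- The wave leaving `x` to the right is the right-moving wave at `x + 1`.
    rw [← hR]
    conv_lhs => rw [gen_evolve_L hU h0 hψ hz (hxB x hx (by omega)), initState_apply_L, ite_self,
      zero_add, mob_of_scattering hb (det_eq hb hd hn) hne hL]
    rfl

/-- The scatterers are the `m + 1` sites strictly between 0 and `m + 2`, hit by a unit wave at site
1. The factor `z` counts the absorbing step, since `outAmp` at `t` belongs to step `t + 1`. -/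
theorem mul_gen_outAmp (hU : U ∈ Matrix.unitaryGroup C1 ℂ) (hc : ‖U L R‖ < 1)
    (hD : ‖D‖ = 1) (hb : U R L = -D * conj (U L R)) (hd : U L L = D * conj (U R R))
    (hn : ‖U R R‖ ^ 2 + ‖U L R‖ ^ 2 = 1) (hz : ‖z‖ < 1) (m : ℕ) :
    z * gen (outAmp U {0, ((m + 2 : ℕ) : ℤ)} (initState 1 1 0)) z =
      refl (U L R) D (m + 1) z := by
  set B : Set ℤ := {0, ((m + 2 : ℕ) : ℤ)} with hBdef
  have h0 : (0 : ℤ) ∈ B := by simp [B]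
  have h1 : (1 : ℤ) ∉ B := notMem_pair (by omega) (by omega)
  have hψ := (energy_initState_one_zero 1).le
  have hbd := fun t y => norm_evolve_apply_le (U := U) hU h0 hψ t y
  have hL := gen_evolve_L_eq_refl hU hc hD hb hd hn hz m 1 le_rfl
    (n := m + 2) (by push_cast; ring)
  have hne := mob_denom_ne_zero hc hD hz.le (norm_refl_le hc hD hz.le m)
  have hout : gen (outAmp U B (initState 1 1 0)) z =
      U L R * gen (fun t => evolve U B (initState 1 1 0) t (1, R)) z +
        U L L * gen (fun t => evolve U B (initState 1 1 0) t (1, L)) z := by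
    rw [← gen_linear (fun t => hbd t _) (fun t => hbd t _) hz]
    congr with t
    exact outAmp_eq t
  have hR := gen_evolve_R hU h0 hψ hz h1
  rw [initState_apply_R, if_pos rfl, sub_self, gen_evolve_of_mem h0, gen_evolve_of_mem h0,
    mul_zero, mul_zero, add_zero, mul_zero, add_zero] at hR
  · have := mob_of_scattering hb (det_eq hb hd hn) hne hL
    rw [← hBdef, hR, mul_one (mob _ _ _ _)] at this
    rw [refl, ← this, hout, hR]
  · rw [initState_apply_L, ite_self]
  · rw [initState_apply_R, if_neg (by omega)]

/-- Before time `n` the walk does not notice the absorbing position `n`. -/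
theorem evolve_pair_eq {n : ℕ} {ψ : State ℤ C1} (hψ : ∀ x : ℤ, 1 < x → ∀ σ, ψ (x, σ) = 0) (t : ℕ) :
    (∀ x : ℤ, t + 1 < x → ∀ σ, evolve U {0} ψ t (x, σ) = 0) ∧
      (t + 1 < n → evolve U {0, (n : ℤ)} ψ t = evolve U {0} ψ t) := by
  induction t with
  | zero => exact ⟨fun x hx => hψ x (by simpa using hx), fun _ => rfl⟩
  | succ t ih =>
    have h1 : ∀ x : ℤ, (t + 1 : ℕ) + 1 < x → ∀ σ, evolve U {0} ψ (t + 1) (x, σ) = 0 := by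
      intro x hx
      push_cast at hx
      have hx0 : x ∉ ({0} : Set ℤ) := by
        rw [Set.mem_singleton_iff]
        omega
      rw [forall_C1, evolve_succ, absorbingWalk_apply_of_notMem _ _ hx0,
        absorbingWalk_apply_of_notMem _ _ hx0, walk_apply_R, walk_apply_L,
        ih.1 _ (by omega), ih.1 _ (by omega), ih.1 _ (by omega), ih.1 _ (by omega)]
      simp
    refine ⟨h1, fun hn => ?_⟩
    ext ⟨x, σ⟩
    rw [evolve_succ, ih.2 (by omega)]
    by_cases hx0 : x = 0
    · rw [evolve_succ, absorbingWalk_apply_of_mem _ _ (by simp [hx0]),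
        absorbingWalk_apply_of_mem _ _ (by simp [hx0])]
    by_cases hxn : x = n
    -- The semi-infinite walk has not reached `n` yet, so the extra projection removes nothing.
    · rw [h1 x (by omega), absorbingWalk_apply_of_mem _ _ (by simp [hxn])]
    · rw [evolve_succ, absorbingWalk_apply_of_notMem _ _ (by simp [hx0, hxn]),
        absorbingWalk_apply_of_notMem _ _ (by simp [hx0])]

theorem outAmp_pair_eq {n : ℕ} {ψ : State ℤ C1} (hψ : ∀ x : ℤ, 1 < x → ∀ σ, ψ (x, σ) = 0) {t : ℕ}
    (ht : t + 1 < n) : outAmp U {0, (n : ℤ)} ψ t = outAmp U {0} ψ t := by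
  rw [outAmp, outAmp, (evolve_pair_eq hψ t).2 ht]

theorem initState_one_apply_of_one_lt (α β : ℂ) :
    ∀ x : ℤ, 1 < x → ∀ σ, initState 1 α β (x, σ) = 0 := by
  intro x hx
  rw [forall_C1, initState_apply_R, initState_apply_L]
  simp only [if_neg (show ¬ x = 1 by omega), and_self]

/-- The generating function of the semi-infinite walk is a fixed point of the Möbius map. -/
theorem mob_mul_gen_outAmp (hU : U ∈ Matrix.unitaryGroup C1 ℂ) (hc : ‖U L R‖ < 1)
    (hD : ‖D‖ = 1) (hb : U R L = -D * conj (U L R)) (hd : U L L = D * conj (U R R))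
    (hn : ‖U R R‖ ^ 2 + ‖U L R‖ ^ 2 = 1) (hz : ‖z‖ < 1) :
    ‖z * gen (outAmp U {0} (initState 1 1 0)) z‖ ≤ 1 ∧
      mob (U L R) D z (z * gen (outAmp U {0} (initState 1 1 0)) z) =
        z * gen (outAmp U {0} (initState 1 1 0)) z := by
  -- Inside the disc, agreement of more and more coefficients forces convergence, and the limit of
  -- an orbit is a fixed point.
  have hlim : Tendsto (fun m => refl (U L R) D (m + 1) z) atTop
      (𝓝 (z * gen (outAmp U {0} (initState 1 1 0)) z)) := by
    simp only [← mul_gen_outAmp hU hc hD hb hd hn hz]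
    refine (tendsto_gen (fun m t => ?_) (fun t => ?_) hz).const_mul z
    · exact norm_outAmp_le hU (by simp) (energy_initState_one_zero 1).le t
    · filter_upwards [eventually_ge_atTop t] with m hm
      exact outAmp_pair_eq (initState_one_apply_of_one_lt 1 0) (by omega)
  have hle := le_of_tendsto' hlim.norm fun m => norm_refl_le hc hD hz.le (m + 1)
  refine ⟨hle, tendsto_nhds_unique ?_ (hlim.comp (tendsto_add_atTop_nat 1))⟩
  exact tendsto_mob hc hD hz.le hle tendsto_const_nhds hlim

end Reflection

/-! ### Uniform separation of the finite and semi-infinite amplitudes -/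

section LowerBound

variable {c D z : ℂ}

/-- `W` need not converge, but by compactness any failure yields a limit point, which is a fixed
point at `z`; `le_norm_refl_sub` covers all of these. Halving the constant leaves the room for a
contradiction. -/
theorem eventually_le_norm_refl_sub (hc : ‖c‖ < 1) (hc0 : c ≠ 0) (hD : ‖D‖ = 1) (hz : ‖z‖ = 1)
    (hband : 1 + ‖c‖ ≤ ‖D * z ^ 2 - 1‖) {ζ W : ℕ → ℂ} (hζ : Tendsto ζ atTop (𝓝 z))
    (hζ1 : ∀ j, ‖ζ j‖ ≤ 1) (hW : ∀ j, ‖W j‖ ≤ 1) (hfix : ∀ j, mob c D (ζ j) (W j) = W j) (m : ℕ) :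
    ∀ᶠ j in atTop, ‖c‖ / 3 * √((1 - ‖c‖) / 3) / 2 ≤ ‖refl c D m (ζ j) - W j‖ := by
  by_contra hcon
  have hfr : ∃ᶠ j in atTop, ‖refl c D m (ζ j) - W j‖ < ‖c‖ / 3 * √((1 - ‖c‖) / 3) / 2 := by
    simpa only [not_eventually, not_le] using hcon
  obtain ⟨φ, hφ, hlt⟩ := extraction_of_frequently_atTop hfr
  obtain ⟨w, hw, χ, hχ, hlim⟩ := (isCompact_closedBall (0 : ℂ) 1).tendsto_subseq
    (x := fun j => W (φ j)) fun j => by simpa using hW (φ j)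
  have hw1 : ‖w‖ ≤ 1 := by simpa using hw
  have hζ' : Tendsto (fun j => ζ (φ (χ j))) atTop (𝓝 z) :=
    hζ.comp (hφ.tendsto_atTop.comp hχ.tendsto_atTop)
  have hlim' : Tendsto (fun j => W (φ (χ j))) atTop (𝓝 w) := hlim
  have hwfix : mob c D z w = w := by
    refine tendsto_nhds_unique (tendsto_mob hc hD hz.le hw1 hζ' hlim') ?_
    simpa only [hfix] using hlim'
  have hrefl : Tendsto (fun j => refl c D m (ζ (φ (χ j)))) atTop (𝓝 (refl c D m z)) := by
    refine (continuousOn_refl hc hD m z (by simp [hz])).tendsto.comp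
      (tendsto_nhdsWithin_iff.2 ⟨hζ', Eventually.of_forall fun j => ?_⟩)
    simpa using hζ1 _
  have h1 := le_of_tendsto' (hrefl.sub hlim').norm fun j => (hlt (χ j)).le
  have h2 := le_norm_refl_sub hc hD hz hw1 hwfix hband m
  have h3 : 0 < ‖c‖ / 3 * √((1 - ‖c‖) / 3) :=
    mul_pos (by have := norm_pos_iff.2 hc0; positivity) (Real.sqrt_pos.2 (by linarith))
  linarith

/-- The frequencies in the transmission band. -/
def band (c D : ℂ) : Set UnitAddCircle := {x | 1 + ‖c‖ < ‖D * fourier 1 x ^ 2 - 1‖}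

theorem isOpen_band : IsOpen (band c D) := isOpen_lt (by fun_prop) (by fun_prop)

/-- Where `D * z ^ 2 = -1` the right side is `2 > 1 + ‖c‖`. -/
theorem band_nonempty (hc : ‖c‖ < 1) (hD : ‖D‖ = 1) : (band c D).Nonempty := by
  obtain ⟨z, hz⟩ := IsAlgClosed.exists_pow_nat_eq (-D⁻¹) two_pos
  have hz1 : ‖z‖ = 1 := by
    have : ‖z‖ ^ 2 = 1 := by rw [← norm_pow, hz, norm_neg, norm_inv, hD, inv_one]
    exact (pow_eq_one_iff_of_nonneg (norm_nonneg z) two_ne_zero).1 this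
  obtain ⟨x, hx⟩ := (AddCircle.homeomorphCircle (one_ne_zero (α := ℝ))).surjective
    ⟨z, mem_sphere_zero_iff_norm.2 hz1⟩
  refine ⟨x, ?_⟩
  have hxz : fourier 1 x = z := by
    rw [fourier_one, ← AddCircle.homeomorphCircle_apply one_ne_zero, hx]
  have hD0 : D ≠ 0 := norm_ne_zero_iff.1 (by rw [hD]; exact one_ne_zero)
  change 1 + ‖c‖ < ‖D * fourier 1 x ^ 2 - 1‖
  rw [hxz, hz, mul_neg, mul_inv_cancel₀ hD0]
  norm_num
  linarith

variable {U : Matrix C1 C1 ℂ}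

theorem exists_le_tsum_outAmp_sub (hU : U ∈ Matrix.unitaryGroup C1 ℂ) (hc : ‖U L R‖ < 1)
    (hc0 : U L R ≠ 0) : ∃ ε : ℝ≥0∞, 0 < ε ∧ ∀ n : ℕ, 2 ≤ n →
      ε ≤ ∑' t, ‖outAmp U {0, (n : ℤ)} (initState 1 1 0) t -
        outAmp U {0} (initState 1 1 0) t‖ₑ ^ 2 := by
  obtain ⟨D, hD, hb, hd, hn⟩ := unitary_entries hU
  set κ : ℝ := ‖U L R‖ / 3 * √((1 - ‖U L R‖) / 3) / 2 with hκ
  have hκ0 : 0 < κ := by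
    have := norm_pos_iff.2 hc0
    have := Real.sqrt_pos.2 (show 0 < (1 - ‖U L R‖) / 3 by linarith)
    positivity
  refine ⟨ENNReal.ofReal κ ^ 2 * haarAddCircle (band (U L R) D), ?_, fun n hn2 => ?_⟩
  · exact ENNReal.mul_pos (pow_ne_zero _ (ENNReal.ofReal_pos.2 hκ0).ne')
      (isOpen_band.measure_pos _ (band_nonempty hc hD)).ne'
  obtain ⟨m, rfl⟩ := Nat.exists_eq_add_of_le' hn2
  have hψ := (energy_initState_one_zero 1).le
  have hbd1 := fun t => norm_outAmp_le (B := {0, ((m + 2 : ℕ) : ℤ)}) hU (by simp) hψ t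
  have hbd2 := fun t => norm_outAmp_le (B := {0}) hU (by simp) hψ t
  let ρ : ℕ → ℝ := fun j => 1 - 1 / ((j : ℝ) + 1)
  have hρ0 : ∀ j, 0 ≤ ρ j := fun j =>
    sub_nonneg.2 ((div_le_one (by positivity)).2 (by linarith [(Nat.cast_nonneg j : (0 : ℝ) ≤ j)]))
  have hρ1 : ∀ j, ρ j < 1 := fun j => sub_lt_self _ (by positivity)
  have hρ : Tendsto ρ atTop (𝓝 1) := by
    simpa [ρ] using (tendsto_const_nhds (x := (1 : ℝ))).sub
      (tendsto_one_div_add_atTop_nhds_zero_nat (𝕜 := ℝ))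
  refine sq_mul_measure_le_tsum (C := 2) (fun t => ?_) hρ0 hρ1 isOpen_band fun x hx => ?_
  · exact (norm_sub_le _ _).trans (by linarith [hbd1 t, hbd2 t])
  have hx1 : ‖fourier 1 x‖ = 1 := norm_fourier_apply 1 x
  have hζn : ∀ j, ‖(ρ j : ℂ) * fourier 1 x‖ = ρ j := fun j => by
    rw [norm_mul, hx1, mul_one, Complex.norm_real, Real.norm_of_nonneg (hρ0 j)]
  have hζ : Tendsto (fun j => (ρ j : ℂ) * fourier 1 x) atTop (𝓝 (fourier 1 x)) := by
    have : Tendsto (fun j => (ρ j : ℂ)) atTop (𝓝 ((1 : ℝ) : ℂ)) :=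
      (Complex.continuous_ofReal.tendsto 1).comp hρ
    simpa using this.mul_const (fourier 1 x)
  have hfix := fun j => mob_mul_gen_outAmp (z := (ρ j : ℂ) * fourier 1 x) hU hc hD hb hd hn
    ((hζn j).trans_lt (hρ1 j))
  filter_upwards [eventually_le_norm_refl_sub hc hc0 hD hx1 (le_of_lt hx) hζ
    (fun j => (hζn j).trans_le (hρ1 j).le) (fun j => (hfix j).1) (fun j => (hfix j).2) (m + 1)]
    with j hj
  have hlt := (hζn j).trans_lt (hρ1 j)
  -- Both reflection amplitudes carry the factor `z` of modulus `ρ j ≤ 1`; dropping it only helps.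
  rw [← mul_gen_outAmp hU hc hD hb hd hn hlt, ← mul_sub, norm_mul, hζn,
    ← gen_sub hbd1 hbd2 hlt] at hj
  rw [← ofReal_norm]
  exact ENNReal.ofReal_le_ofReal (hj.trans (mul_le_of_le_one_left (norm_nonneg _) (hρ1 j).le))

end LowerBound

/-! ### Comparison of the absorption probabilities -/

section Comparison

theorem enorm_sub_sq_le (p q : ℂ) : ‖p - q‖ₑ ^ 2 ≤ 2 * ‖p‖ₑ ^ 2 + 2 * ‖q‖ₑ ^ 2 := by
  have h : ‖p - q‖ ^ 2 ≤ 2 * ‖p‖ ^ 2 + 2 * ‖q‖ ^ 2 := by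
    have := norm_sub_le p q
    nlinarith [norm_nonneg (p - q), sq_nonneg (‖p‖ - ‖q‖)]
  have h2 : (2 : ℝ≥0∞) = ENNReal.ofReal 2 := by simp
  rw [enorm_sq_eq_ofReal, enorm_sq_eq_ofReal, enorm_sq_eq_ofReal, h2,
    ← ENNReal.ofReal_mul zero_le_two, ← ENNReal.ofReal_mul zero_le_two,
    ← ENNReal.ofReal_add (by positivity) (by positivity)]
  exact ENNReal.ofReal_le_ofReal h

/-- If `F n` agrees with `f` on longer and longer initial segments, but stays away from `f` in
`ℓ²`, then the norm of `F n` is eventually at least that of `f`. -/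
theorem eventually_tsum_sq_le {F : ℕ → ℕ → ℂ} {f : ℕ → ℂ} (hf : ∑' t, ‖f t‖ₑ ^ 2 ≠ ∞)
    (hF : ∀ n t, t + 1 < n → F n t = f t) {ε : ℝ≥0∞} (hε : 0 < ε)
    (h : ∀ n, 2 ≤ n → ε ≤ ∑' t, ‖F n t - f t‖ₑ ^ 2) :
    ∀ᶠ n in atTop, ∑' t, ‖f t‖ₑ ^ 2 ≤ ∑' t, ‖F n t‖ₑ ^ 2 := by
  -- If the tail of `F n` were the smaller one, `enorm_sub_sq_le` would bound `ε` by `2 + 2` tails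
  -- of `f`.
  have htail : Tendsto (fun m => 4 * ∑' t, ‖f (t + m)‖ₑ ^ 2) atTop (𝓝 0) := by
    simpa using ENNReal.Tendsto.const_mul
      (ENNReal.tendsto_sum_nat_add (fun t => ‖f t‖ₑ ^ 2) hf) (Or.inr (by simp : (4 : ℝ≥0∞) ≠ ∞))
  obtain ⟨N, hN⟩ := ((htail.eventually_lt_const hε).and (eventually_ge_atTop 1)).exists_forall_of_atTop
  filter_upwards [eventually_ge_atTop (N + 1)] with n hn
  obtain ⟨m, rfl⟩ : ∃ m, n = m + 1 := ⟨n - 1, by omega⟩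
  obtain ⟨hm, hm1⟩ := hN m (by omega)
  have hsplit : ∀ g : ℕ → ℂ, ∑' t, ‖g t‖ₑ ^ 2 =
      ∑ t ∈ Finset.range m, ‖g t‖ₑ ^ 2 + ∑' t, ‖g (t + m)‖ₑ ^ 2 := fun g =>
    (Summable.sum_add_tsum_nat_add' (f := fun t => ‖g t‖ₑ ^ 2) ENNReal.summable).symm
  have heq : ∀ t ∈ Finset.range m, F (m + 1) t = f t := fun t ht =>
    hF _ _ (by have := Finset.mem_range.1 ht; omega)
  have h1 := h (m + 1) (by omega)
  rw [hsplit fun t => F (m + 1) t - f t,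
    Finset.sum_eq_zero fun t ht => by simp [heq t ht], zero_add] at h1
  rw [hsplit, hsplit (F (m + 1)), Finset.sum_congr rfl fun t ht => congrArg (‖·‖ₑ ^ 2) (heq t ht)]
  refine add_le_add_right ?_ _
  by_contra! hlt
  have h2 : ε ≤ 2 * ∑' t, ‖F (m + 1) (t + m)‖ₑ ^ 2 + 2 * ∑' t, ‖f (t + m)‖ₑ ^ 2 := by
    rw [← ENNReal.tsum_mul_left, ← ENNReal.tsum_mul_left, ← ENNReal.tsum_add]
    exact h1.trans (ENNReal.tsum_le_tsum fun t => enorm_sub_sq_le _ _)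
  refine absurd hm (not_lt.2 (h2.trans ?_))
  calc _ ≤ 2 * ∑' t, ‖f (t + m)‖ₑ ^ 2 + 2 * ∑' t, ‖f (t + m)‖ₑ ^ 2 :=
        add_le_add_left (mul_le_mul_right hlt.le _) _
    _ = _ := by rw [← add_mul, two_add_two_eq_four]

variable {U : Matrix C1 C1 ℂ}

/-- A coin that only transmits never returns the walk to `0`. -/
theorem absorptionProb_eq_zero_of_transmitting (hc : U L R = 0) :
    absorptionProb U (atPos {0}) (atPos {0}) (initState 2 1 0) = 0 := by
  rw [absorptionProb_eq_tsum (Set.mem_singleton 0) (initState_apply_nonpos two_pos 1 0), ENNReal.tsum_eq_zero]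
  have h : ∀ t x, evolve U {0} (initState 2 1 0) t (x, L) = 0 := by
    intro t
    induction t with
    | zero => intro x; rw [evolve_zero, initState_apply_L, ite_self]
    | succ t ih =>
      intro x
      by_cases hx : x ∈ ({0} : Set ℤ)
      · rw [evolve_succ, absorbingWalk_apply_of_mem _ _ hx]
      · rw [evolve_succ, absorbingWalk_apply_of_notMem _ _ hx, walk_apply_L, ih, hc]
        simp
  intro t
  rw [outAmp_eq, h, hc]
  simp

/-- A coin that only reflects keeps the walk between the positions `1` and `2`. -/
theorem absorptionProb_eq_zero_of_reflecting (ha : U R R = 0) (hd : U L L = 0) :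
    absorptionProb U (atPos {0}) (atPos {0}) (initState 2 1 0) = 0 := by
  rw [absorptionProb_eq_tsum (Set.mem_singleton 0) (initState_apply_nonpos two_pos 1 0), ENNReal.tsum_eq_zero]
  have h : ∀ t, (∀ x, x ≠ 2 → evolve U {0} (initState 2 1 0) t (x, R) = 0) ∧
      ∀ x, x ≠ 1 → evolve U {0} (initState 2 1 0) t (x, L) = 0 := by
    intro t
    induction t with
    | zero =>
      exact ⟨fun x hx => by rw [evolve_zero, initState_apply_R, if_neg hx],
        fun x _ => by rw [evolve_zero, initState_apply_L, ite_self]⟩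
    | succ t ih =>
      refine ⟨fun x hx => ?_, fun x hx => ?_⟩
      · by_cases hx0 : x ∈ ({0} : Set ℤ)
        · rw [evolve_succ, absorbingWalk_apply_of_mem _ _ hx0]
        · rw [evolve_succ, absorbingWalk_apply_of_notMem _ _ hx0, walk_apply_R,
            ih.2 _ (by omega), ha]
          simp
      · by_cases hx0 : x ∈ ({0} : Set ℤ)
        · rw [evolve_succ, absorbingWalk_apply_of_mem _ _ hx0]
        · rw [evolve_succ, absorbingWalk_apply_of_notMem _ _ hx0, walk_apply_L,
            ih.1 _ (by omega), hd]
          simp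
  intro t
  rw [outAmp_eq, (h t).1 _ (by omega), hd]
  simp

/-- For degenerate coins the left side vanishes. Otherwise the start `|1⟩|R⟩` is used, where the
scattering description applies. -/
theorem eventually_absorptionProb_two_le (hU : U ∈ Matrix.unitaryGroup C1 ℂ) :
    ∀ᶠ n : ℕ in atTop, absorptionProb U (atPos {0}) (atPos {0}) (initState 2 1 0) ≤
      absorptionProb U (atPos {0, (n : ℤ)}) (atPos {0}) (initState 2 1 0) := by
  obtain ⟨D, hD, hb, hd, hn⟩ := unitary_entries hU
  by_cases ha : U R R = 0
  · rw [absorptionProb_eq_zero_of_reflecting ha (by rw [hd, ha, map_zero, mul_zero])]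
    simp
  by_cases hc0 : U L R = 0
  · rw [absorptionProb_eq_zero_of_transmitting hc0]
    simp
  have ha0 := norm_pos_iff.2 ha
  have hc : ‖U L R‖ < 1 := by nlinarith [norm_nonneg (U L R)]
  obtain ⟨ε, hε, hle⟩ := exists_le_tsum_outAmp_sub hU hc hc0
  have hfin : ∑' t, ‖outAmp U {0} (initState 1 1 0) t‖ₑ ^ 2 ≠ ⊤ :=
    ((tsum_outAmp_le hU (Set.mem_singleton 0)).trans_lt
      (by rw [energy_initState_one_zero]; exact ENNReal.one_lt_top)).ne
  filter_upwards [eventually_tsum_sq_le (F := fun n : ℕ => outAmp U {0, (n : ℤ)} (initState 1 1 0))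
    hfin (fun n t ht => outAmp_pair_eq (initState_one_apply_of_one_lt 1 0) ht) hε hle,
    eventually_gt_atTop 2] with n hn hn2
  have h2 : (2 : ℤ) ∉ ({0, (n : ℤ)} : Set ℤ) := notMem_pair (by omega) (by omega)
  have hψ := initState_apply_nonpos one_pos 1 0
  rw [← absorptionProb_eq_tsum (Set.mem_singleton 0) hψ, ← absorptionProb_eq_tsum (by simp) hψ,
    -- Both sides become `‖U L R‖ₑ ^ 2` plus `‖U R R‖ₑ ^ 2` times the probability from `|2⟩|R⟩`;
    -- finiteness and `U R R ≠ 0` allow cancelling.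
    absorptionProb_initState_one (Set.mem_singleton 0) (by simp), absorptionProb_initState_one (by simp) h2,
    mul_zero, mul_one, mul_zero, mul_one, add_zero, add_zero,
    ENNReal.add_le_add_iff_left (by simp)] at hn
  exact (ENNReal.mul_le_mul_iff_right (by simpa using ha) (by simp)).1 hn

end Comparison

end QuantumWalk

end

theorem theorem4p3
    (U : Matrix QuantumWalk.C1 QuantumWalk.C1 ℂ)
    (hU : U ∈ Matrix.unitaryGroup QuantumWalk.C1 ℂ) :
    ∃ N : ℕ, ∀ n : ℕ, N ≤ n → ∀ α β : ℂ, ‖α‖ ^ 2 + ‖β‖ ^ 2 = 1 →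
      QuantumWalk.PInf U 1 α β ≤ QuantumWalk.PFin U n 1 α β := by
  obtain ⟨N, hN⟩ := Filter.eventually_atTop.1 (QuantumWalk.eventually_absorptionProb_two_le hU)
  -- From `n = 3` on, position 2 is not absorbing, as the first-step decomposition requires.
  refine ⟨max N 3, fun n hn α β _ => ?_⟩
  have h3 := le_of_max_le_right hn
  have h2 : (2 : ℤ) ∉ ({0, (n : ℤ)} : Set ℤ) := QuantumWalk.notMem_pair (by omega) (by omega)
  rw [QuantumWalk.PInf, QuantumWalk.PFin,
    QuantumWalk.absorptionProb_initState_one (Set.mem_singleton 0) (by simp),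
    QuantumWalk.absorptionProb_initState_one (by simp) h2]
  gcongr
  exact hN n (le_of_max_le_left hn)
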